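/- Let $E$ and $F$ be Archimedean (real) vector lattices, each equipped with a locally convex-solid topology, i.e. a linear topology (not necessarily Hausdorff) having a base of zero neighbourhoods that are convex and solid. Let $E\overline{\otimes}F$ be the Fremlin tensor product of $E$ and $F$: the Archimedean vector lattice, with lattice bimorphism $E\times F\to E\overline{\otimes}F$, $(x,y)\mapsto x\otimes y$, through which every lattice bimorphism $\Phi$ from $E\times F$ to an Archimedean vector lattice $G$ factors as $\Phi(x,y)=T(x\otimes y)$ for a unique lattice homomorphism $T:E\overline{\otimes}F\to G$. For $U\subseteq E$ and $V\subseteq F$ put \[U\otimes V=\{x\otimes y: x\in U,\ y\in V\}\quad\text{and}\quad W_{U,V}=\mathrm{Conv}_b(\mathrm{Sol}(U\otimes V)),\] where $\mathrm{Sol}(A)=\{z:\ |z|\le |a| \text{ for some } a\in A\}$ is the solid hull and $\mathrm{Conv}_b(A)=\{\sum_{i=1}^n\lambda_i a_i:\ n\ge 1,\ a_i\in A,\ \lambda_i\in\mathbb{R},\ \sum_{i=1}^n|\lambda_i|\le 1\}$ is the convex balanced hull. Then there is exactly one topology $\tau_F$ on $E\overline{\otimes}F$ such that $(E\overline{\otimes}F,\tau_F)$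 is a locally convex-solid vector lattice and, for every base $\mathcal{U}$ of convex-solid zero neighbourhoods of $E$ and every base $\mathcal{V}$ of convex-solid zero neighbourhoods of $F$, the family $\{W_{U,V}: U\in\mathcal{U},\ V\in\mathcal{V}\}$ is a base of convex-solid zero neighbourhoods for $\tau_F$. -/

import Mathlib

open Topology

universe u v w

section VectorLattices

/-- A vector lattice is Archimedean if `n x ≤ y` for all `n : ℕ` forces `x ≤ 0`. -/
class IsArchimedeanVectorLattice (E : Type u) [AddCommGroup E] [Lattice E] [Module ℝ E] :
    Prop where
  le_zero_of_forall_smul_le : ∀ x y : E, (∀ n : ℕ, (n : ℝ) • x ≤ y) → x ≤ 0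

/-- Lattice homomorphisms: linear maps preserving binary suprema and infima. -/
def IsLatticeHomomorphism {E : Type u} {G : Type w} [AddCommGroup E] [Lattice E] [Module ℝ E]
    [AddCommGroup G] [Lattice G] [Module ℝ G] (T : E →ₗ[ℝ] G) : Prop :=
  (∀ a b, T (a ⊔ b) = T a ⊔ T b) ∧ (∀ a b, T (a ⊓ b) = T a ⊓ T b)

/-- Lattice bimorphisms: bilinear maps `Φ` such that `Φ(x, ·)` and `Φ(·, y)` are lattice
homomorphisms for all `x ≥ 0` and `y ≥ 0`. -/
def IsLatticeBimorphism {E : Type u} {F : Type v} {G : Type w}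
    [AddCommGroup E] [Lattice E] [Module ℝ E] [AddCommGroup F] [Lattice F] [Module ℝ F]
    [AddCommGroup G] [Lattice G] [Module ℝ G] (Φ : E →ₗ[ℝ] F →ₗ[ℝ] G) : Prop :=
  (∀ x, 0 ≤ x → IsLatticeHomomorphism (Φ x)) ∧
    (∀ y, 0 ≤ y → IsLatticeHomomorphism (Φ.flip y))

/-- A family `𝓑` of sets is a base of convex-solid zero neighbourhoods. -/
structure IsConvexSolidZeroBase (E : Type u) [AddCommGroup E] [Lattice E] [Module ℝ E]
    [TopologicalSpace E] (𝓑 : Set (Set E)) : Prop where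
  hasBasis : (𝓝 (0 : E)).HasBasis (fun U : Set E => U ∈ 𝓑) id
  convex : ∀ U ∈ 𝓑, Convex ℝ U
  solid : ∀ U ∈ 𝓑, LatticeOrderedAddCommGroup.IsSolid U

/-- A locally convex-solid topology on a vector lattice: a linear topology (not necessarily
Hausdorff) that has a base of convex-solid zero neighbourhoods. -/
structure IsLocallyConvexSolid (E : Type u) [AddCommGroup E] [Lattice E] [Module ℝ E]
    [TopologicalSpace E] : Prop where
  continuous_add : ContinuousAdd E
  continuous_smul : ContinuousSMul ℝ E
  exists_base : ∃ 𝓑 : Set (Set E), IsConvexSolidZeroBase E 𝓑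

end VectorLattices

/-- Formal vector lattice expressions in the symbols `x ⊗ y`. -/
inductive FremlinTerm (E : Type u) (F : Type v) : Type (max u v)
  | tmul (x : E) (y : F) : FremlinTerm E F
  | zero : FremlinTerm E F
  | add (a b : FremlinTerm E F) : FremlinTerm E F
  | smul (r : ℝ) (a : FremlinTerm E F) : FremlinTerm E F
  | sup (a b : FremlinTerm E F) : FremlinTerm E F

section Construction

variable (E : Type u) (F : Type v)
  [AddCommGroup E] [Lattice E] [Module ℝ E]
  [AddCommGroup F] [Lattice F] [Module ℝ F]

namespace FremlinTerm

/-- The defining equations: those of a real vector space, and those saying that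
`(x, y) ↦ x ⊗ y` is a lattice bimorphism. -/
inductive Eqn : FremlinTerm E F → FremlinTerm E F → Prop
  | add_assoc (a b c) : Eqn (add (add a b) c) (add a (add b c))
  | add_comm (a b) : Eqn (add a b) (add b a)
  | zero_add (a) : Eqn (add zero a) a
  | neg_add (a) : Eqn (add (smul (-1) a) a) zero
  | smul_add (r a b) : Eqn (smul r (add a b)) (add (smul r a) (smul r b))
  | add_smul (r s a) : Eqn (smul (r + s) a) (add (smul r a) (smul s a))
  | mul_smul (r s a) : Eqn (smul (r * s) a) (smul r (smul s a))
  | one_smul (a) : Eqn (smul 1 a) a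
  | add_tmul (x x' y) : Eqn (tmul (x + x') y) (add (tmul x y) (tmul x' y))
  | tmul_add (x y y') : Eqn (tmul x (y + y')) (add (tmul x y) (tmul x y'))
  | smul_tmul (r : ℝ) (x y) : Eqn (tmul (r • x) y) (smul r (tmul x y))
  | tmul_smul (r : ℝ) (x y) : Eqn (tmul x (r • y)) (smul r (tmul x y))
  | sup_tmul (x x' y) : 0 ≤ y → Eqn (tmul (x ⊔ x') y) (sup (tmul x y) (tmul x' y))
  | tmul_sup (x y y') : 0 ≤ x → Eqn (tmul x (y ⊔ y')) (sup (tmul x y) (tmul x y'))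

/-- The smallest preorder on expressions that satisfies the defining equations, makes the
expressions a vector lattice and makes this vector lattice Archimedean. -/
inductive Le : FremlinTerm E F → FremlinTerm E F → Prop
  | refl (a) : Le a a
  | trans {a b c} : Le a b → Le b c → Le a c
  | of_eqn {a b} : Eqn E F a b → Le a b
  | of_eqn_symm {a b} : Eqn E F a b → Le b a
  | add_le_add {a b} (c) : Le a b → Le (add c a) (add c b)
  | smul_mono {r : ℝ} {a b} : 0 ≤ r → Le a b → Le (smul r a) (smul r b)
  | smul_anti {r : ℝ} {a b} : r ≤ 0 → Le a b → Le (smul r b) (smul r a)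
  | le_sup_left (a b) : Le a (sup a b)
  | le_sup_right (a b) : Le b (sup a b)
  | sup_le {a b c} : Le a c → Le b c → Le (sup a b) c
  | archimedean {a b} : (∀ n : ℕ, Le (smul (n : ℝ) a) b) → Le a zero

/-- Two expressions are identified if each is below the other. -/
instance setoid : Setoid (FremlinTerm E F) where
  r a b := Le E F a b ∧ Le E F b a
  iseqv :=
    { refl := fun a => ⟨.refl a, .refl a⟩
      symm := fun h => ⟨h.2, h.1⟩
      trans := fun h k => ⟨h.1.trans k.1, k.2.trans h.2⟩ }

end FremlinTerm

/-- The Fremlin tensor product `E ⊗̄ F` of Archimedean vector lattices: the Archimedean vector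
lattice generated by the symbols `x ⊗ y` subject to the relations which say that
`(x, y) ↦ x ⊗ y` is a lattice bimorphism. Its characteristic properties are
`FremlinTensorProduct.existsUnique_lift` and `FremlinTensorProduct.generated`. -/
def FremlinTensorProduct : Type (max u v) := Quotient (FremlinTerm.setoid E F)

namespace FremlinTensorProduct

open FremlinTerm

variable {E F}

theorem sound {a b : FremlinTerm E F} (h : Eqn E F a b) :
    (Quotient.mk (setoid E F) a) = Quotient.mk (setoid E F) b :=
  Quotient.sound ⟨.of_eqn h, .of_eqn_symm h⟩

theorem le_add_add {a a' b b' : FremlinTerm E F} (h : Le E F a a') (k : Le E F b b') :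
    Le E F (add a b) (add a' b') :=
  (Le.add_le_add a k).trans <| (Le.of_eqn (.add_comm _ _)).trans <|
    (Le.add_le_add b' h).trans (Le.of_eqn (.add_comm _ _))

theorem le_sup_sup {a a' b b' : FremlinTerm E F} (h : Le E F a a') (k : Le E F b b') :
    Le E F (sup a b) (sup a' b') :=
  Le.sup_le (h.trans (.le_sup_left _ _)) (k.trans (.le_sup_right _ _))

instance : Zero (FremlinTensorProduct E F) := ⟨Quotient.mk (setoid E F) zero⟩

instance : Add (FremlinTensorProduct E F) :=
  ⟨Quotient.map₂ add fun _ _ h _ _ k => ⟨le_add_add h.1 k.1, le_add_add h.2 k.2⟩⟩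

instance : SMul ℝ (FremlinTensorProduct E F) :=
  ⟨fun r => Quotient.map (smul r) fun _ _ h =>
    (le_total 0 r).elim (fun hr => ⟨.smul_mono hr h.1, .smul_mono hr h.2⟩)
      (fun hr => ⟨.smul_anti hr h.2, .smul_anti hr h.1⟩)⟩

instance : Neg (FremlinTensorProduct E F) := ⟨fun a => (-1 : ℝ) • a⟩

/-- The supremum on the quotient. -/
def join : FremlinTensorProduct E F → FremlinTensorProduct E F → FremlinTensorProduct E F :=
  Quotient.map₂ sup fun _ _ h _ _ k => ⟨le_sup_sup h.1 k.1, le_sup_sup h.2 k.2⟩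

instance : LE (FremlinTensorProduct E F) :=
  ⟨Quotient.lift₂ (Le E F) fun _ _ _ _ h k =>
    propext ⟨fun l => (h.2.trans l).trans k.1, fun l => (h.1.trans l).trans k.2⟩⟩

instance : AddCommGroup (FremlinTensorProduct E F) where
  add_assoc := by
    rintro ⟨a⟩ ⟨b⟩ ⟨c⟩
    exact sound (.add_assoc a b c)
  zero_add := by
    rintro ⟨a⟩
    exact sound (.zero_add a)
  add_zero := by
    rintro ⟨a⟩
    exact (sound (.add_comm a zero)).trans (sound (.zero_add a))
  neg_add_cancel := by
    rintro ⟨a⟩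
    exact sound (.neg_add a)
  add_comm := by
    rintro ⟨a⟩ ⟨b⟩
    exact sound (.add_comm a b)
  nsmul := nsmulRec
  zsmul := zsmulRec

instance : Module ℝ (FremlinTensorProduct E F) :=
  Module.ofMinimalAxioms
    (by
      rintro r ⟨a⟩ ⟨b⟩
      exact sound (.smul_add r a b))
    (by
      rintro r s ⟨a⟩
      exact sound (.add_smul r s a))
    (by
      rintro r s ⟨a⟩
      exact sound (.mul_smul r s a))
    (by
      rintro ⟨a⟩
      exact sound (.one_smul a))

instance : PartialOrder (FremlinTensorProduct E F) where
  le_refl := by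
    rintro ⟨a⟩
    exact Le.refl a
  le_trans := by
    rintro ⟨a⟩ ⟨b⟩ ⟨c⟩ h k
    exact Le.trans (show Le E F a b from h) (show Le E F b c from k)
  le_antisymm := by
    rintro ⟨a⟩ ⟨b⟩ h k
    exact Quotient.sound ⟨h, k⟩

instance : IsOrderedAddMonoid (FremlinTensorProduct E F) where
  add_le_add_left := by
    rintro ⟨a⟩ ⟨b⟩ h ⟨c⟩
    exact le_add_add (show Le E F a b from h) (Le.refl c)

instance : PosSMulMono ℝ (FremlinTensorProduct E F) where
  smul_le_smul_of_nonneg_left := by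
    rintro r hr ⟨a⟩ ⟨b⟩ h
    exact Le.smul_mono hr (show Le E F a b from h)

/-- The infimum is `a ⊓ b = -((-a) ⊔ (-b))`. -/
instance : Lattice (FremlinTensorProduct E F) where
  sup := join
  le_sup_left := by
    rintro ⟨a⟩ ⟨b⟩
    exact Le.le_sup_left a b
  le_sup_right := by
    rintro ⟨a⟩ ⟨b⟩
    exact Le.le_sup_right a b
  sup_le := by
    rintro ⟨a⟩ ⟨b⟩ ⟨c⟩ h k
    exact Le.sup_le (show Le E F a c from h) (show Le E F b c from k)
  inf a b := -(join (-a) (-b))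
  inf_le_left := by
    intro a b
    have h : -a ≤ join (-a) (-b) := by
      induction a using Quotient.ind
      induction b using Quotient.ind
      exact Le.le_sup_left _ _
    exact neg_le.mp h
  inf_le_right := by
    intro a b
    have h : -b ≤ join (-a) (-b) := by
      induction a using Quotient.ind
      induction b using Quotient.ind
      exact Le.le_sup_right _ _
    exact neg_le.mp h
  le_inf := by
    intro a b c h k
    have h' := neg_le_neg h
    have k' := neg_le_neg k
    have l : join (-b) (-c) ≤ -a := by
      revert h' k'
      induction a using Quotient.ind
      induction b using Quotient.ind
      induction c using Quotient.ind
      exact fun h' k' => Le.sup_le h' k'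
    exact le_neg.mp l

instance : IsArchimedeanVectorLattice (FremlinTensorProduct E F) where
  le_zero_of_forall_smul_le := by
    rintro ⟨a⟩ ⟨b⟩ h
    exact Le.archimedean (fun n => h n)

/-- The canonical bilinear map `(x, y) ↦ x ⊗ y`. -/
def tmul : E →ₗ[ℝ] F →ₗ[ℝ] FremlinTensorProduct E F :=
  LinearMap.mk₂ ℝ (fun x y => Quotient.mk (setoid E F) (FremlinTerm.tmul x y))
    (fun x x' y => sound (.add_tmul x x' y)) (fun r x y => sound (.smul_tmul r x y))
    (fun x y y' => sound (.tmul_add x y y')) (fun r x y => sound (.tmul_smul r x y))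

/-- `E ⊗̄ F` is the smallest vector sublattice containing all `x ⊗ y`. -/
theorem generated (P : FremlinTensorProduct E F → Prop)
    (h_tmul : ∀ x y, P (tmul x y)) (h_zero : P 0) (h_add : ∀ a b, P a → P b → P (a + b))
    (h_smul : ∀ (r : ℝ) a, P a → P (r • a)) (h_sup : ∀ a b, P a → P b → P (a ⊔ b))
    (a : FremlinTensorProduct E F) : P a := by
  induction a using Quotient.ind with
  | _ a =>
    induction a with
    | tmul x y => exact h_tmul x y
    | zero => exact h_zero
    | add a b ha hb => exact h_add _ _ ha hb
    | smul r a ha => exact h_smul r _ ha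
    | sup a b ha hb => exact h_sup _ _ ha hb

theorem map_inf_of_map_sup {V : Type u} {G : Type w} [AddCommGroup V] [Lattice V]
    [IsOrderedAddMonoid V] [Module ℝ V] [AddCommGroup G] [Lattice G] [IsOrderedAddMonoid G]
    [Module ℝ G] (T : V →ₗ[ℝ] G) (h : ∀ a b, T (a ⊔ b) = T a ⊔ T b) (a b : V) :
    T (a ⊓ b) = T a ⊓ T b := by
  have e := h (-a) (-b)
  rw [← neg_inf, map_neg, map_neg, map_neg, ← neg_inf] at e
  exact neg_injective e

theorem isLatticeBimorphism_tmul [IsOrderedAddMonoid E] [IsOrderedAddMonoid F] :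
    IsLatticeBimorphism (tmul : E →ₗ[ℝ] F →ₗ[ℝ] FremlinTensorProduct E F) := by
  refine ⟨fun x hx => ?_, fun y hy => ?_⟩
  · have h : ∀ a b, tmul x (a ⊔ b) = tmul x a ⊔ (tmul x b : FremlinTensorProduct E F) :=
      fun a b => sound (.tmul_sup x a b hx)
    exact ⟨h, map_inf_of_map_sup _ h⟩
  · have h : ∀ a b, (tmul : E →ₗ[ℝ] F →ₗ[ℝ] FremlinTensorProduct E F).flip y (a ⊔ b) =
        tmul a y ⊔ tmul b y := fun a b => sound (.sup_tmul a b y hy)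
    exact ⟨h, map_inf_of_map_sup _ h⟩

section Lift

variable {G : Type w} [AddCommGroup G] [Lattice G] [Module ℝ G]

/-- The value of an expression in `G`, with `x ⊗ y` read as `Φ(x, y)`. -/
def eval (Φ : E →ₗ[ℝ] F →ₗ[ℝ] G) : FremlinTerm E F → G
  | .tmul x y => Φ x y
  | .zero => 0
  | .add a b => eval Φ a + eval Φ b
  | .smul r a => r • eval Φ a
  | .sup a b => eval Φ a ⊔ eval Φ b

theorem eval_eq (Φ : E →ₗ[ℝ] F →ₗ[ℝ] G) (hΦ : IsLatticeBimorphism Φ) {a b : FremlinTerm E F}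
    (h : Eqn E F a b) : eval Φ a = eval Φ b := by
  cases h with
  | add_assoc a b c => exact _root_.add_assoc _ _ _
  | add_comm a b => exact _root_.add_comm _ _
  | zero_add a => exact _root_.zero_add _
  | neg_add a => simp [eval]
  | smul_add r a b => exact _root_.smul_add _ _ _
  | add_smul r s a => exact _root_.add_smul _ _ _
  | mul_smul r s a => exact SemigroupAction.mul_smul _ _ _
  | one_smul a => exact _root_.one_smul _ _
  | add_tmul x x' y => simp [eval]
  | tmul_add x y y' => simp [eval]
  | smul_tmul r x y => simp [eval]
  | tmul_smul r x y => simp [eval]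
  | sup_tmul x x' y hy => exact (hΦ.2 y hy).1 x x'
  | tmul_sup x y y' hx => exact (hΦ.1 x hx).1 y y'

variable [IsOrderedAddMonoid G] [PosSMulMono ℝ G] [IsArchimedeanVectorLattice G]

theorem eval_le (Φ : E →ₗ[ℝ] F →ₗ[ℝ] G) (hΦ : IsLatticeBimorphism Φ) {a b : FremlinTerm E F}
    (h : Le E F a b) : eval Φ a ≤ eval Φ b := by
  induction h with
  | refl a => exact le_rfl
  | trans _ _ h k => exact h.trans k
  | of_eqn h => exact (eval_eq Φ hΦ h).le
  | of_eqn_symm h => exact (eval_eq Φ hΦ h).ge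
  | add_le_add c _ h => exact add_le_add_right h _
  | smul_mono hr _ h => exact smul_le_smul_of_nonneg_left h hr
  | smul_anti hr _ h => exact smul_le_smul_of_nonpos_left h hr
  | le_sup_left a b => exact _root_.le_sup_left
  | le_sup_right a b => exact _root_.le_sup_right
  | sup_le _ _ h k => exact _root_.sup_le h k
  | archimedean _ h => exact IsArchimedeanVectorLattice.le_zero_of_forall_smul_le _ _ h

/-- The universal property of the Fremlin tensor product. -/
theorem existsUnique_lift (Φ : E →ₗ[ℝ] F →ₗ[ℝ] G) (hΦ : IsLatticeBimorphism Φ) :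
    ∃! T : FremlinTensorProduct E F →ₗ[ℝ] G,
      IsLatticeHomomorphism T ∧ ∀ x y, T (tmul x y) = Φ x y := by
  let T : FremlinTensorProduct E F →ₗ[ℝ] G :=
    { toFun := Quotient.lift (eval Φ) fun a b h =>
        le_antisymm (eval_le Φ hΦ h.1) (eval_le Φ hΦ h.2)
      map_add' := by
        rintro ⟨a⟩ ⟨b⟩
        rfl
      map_smul' := by
        rintro r ⟨a⟩
        rfl }
  have hT : ∀ a b, T (a ⊔ b) = T a ⊔ T b := by
    rintro ⟨a⟩ ⟨b⟩
    rfl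
  refine ⟨T, ⟨⟨hT, map_inf_of_map_sup T hT⟩, fun x y => rfl⟩, ?_⟩
  rintro S ⟨hS, hSΦ⟩
  ext a
  induction a using generated with
  | h_tmul x y => exact hSΦ x y
  | h_zero => rw [map_zero, map_zero]
  | h_add a b ha hb => rw [map_add, map_add, ha, hb]
  | h_smul r a ha => rw [map_smul, map_smul, ha]
  | h_sup a b ha hb => rw [hS.1, hT, ha, hb]

end Lift

end FremlinTensorProduct

variable {E F}

/-- `W_{U,V} = Conv_b (Sol (U ⊗ V))`, where `U ⊗ V = {x ⊗ y : x ∈ U, y ∈ V}`, `Sol` is the solid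
hull and `Conv_b` the convex balanced hull in the Fremlin tensor product. -/
def fremlinNhd (U : Set E) (V : Set F) : Set (FremlinTensorProduct E F) :=
  absConvexHull ℝ (LatticeOrderedAddCommGroup.solidClosure
    (Set.image2 (fun x y => FremlinTensorProduct.tmul x y) U V))

end Construction

/-! A group topology is determined by its zero neighbourhoods, which gives uniqueness. For
existence, the sets `W_{U,V}`, with `U` and `V` running over all zero neighbourhoods, are shown to
form a module filter basis; since `W_{U,V}` is monotone in `U` and `V`, any bases of `E` and `F`
then yield a base. Convexity and balancedness are built into `W_{U,V}`, and scalars can be moved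
into the first tensor factor (`smul_mem_fremlinNhd`). Two points need the order. The absolutely
convex hull of a solid set is solid, by Riesz decomposition (`isSolid_absConvexHull`). And `W_{U,V}`
is absorbing: every element is dominated by some `x ⊗ y` (`exists_abs_le_tmul`), and multiples of `x
⊗ y` are absorbed factor by factor. -/

open LatticeOrderedAddCommGroup

/-! ### Riesz decomposition and solid hulls in vector lattices. -/

section VectorLattice

variable {G : Type*} [AddCommGroup G] [Lattice G]

theorem abs_smul_le_smul_abs [Module ℝ G] [PosSMulMono ℝ G] (r : ℝ) (z : G) :
    |r • z| ≤ |r| • |z| := by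
  have key : ∀ s : ℝ, 0 ≤ s → |s • z| ≤ s • |z| := fun s hs =>
    abs_le'.2 ⟨smul_le_smul_of_nonneg_left (le_abs_self z) hs, by
      rw [← smul_neg]; exact smul_le_smul_of_nonneg_left (neg_le_abs z) hs⟩
  rcases le_total 0 r with hr | hr
  · rw [abs_of_nonneg hr]; exact key r hr
  · rw [abs_of_nonpos hr, ← abs_neg, ← neg_smul]; exact key _ (neg_nonneg.2 hr)

variable [IsOrderedAddMonoid G]

theorem abs_le_iff_neg_le_and_le {a b : G} : |a| ≤ b ↔ -b ≤ a ∧ a ≤ b := by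
  rw [abs_le', neg_le, and_comm]

/-- The Riesz decomposition property. -/
theorem exists_add_eq_of_abs_le_add {y a b : G} (ha : 0 ≤ a) (hb : 0 ≤ b) (h : |y| ≤ a + b) :
    ∃ y₁ y₂, y = y₁ + y₂ ∧ |y₁| ≤ a ∧ |y₂| ≤ b := by
  obtain ⟨h₁, h₂⟩ := abs_le_iff_neg_le_and_le.1 h
  have hna : -a ≤ a := neg_le_self ha
  -- The first summand is `y` truncated to the interval `[-a, a]`; what is cut off lies in `[-b,
  -- b]`.
  refine ⟨(y ⊓ a) ⊔ -a, y - ((y ⊓ a) ⊔ -a), (add_sub_cancel _ _).symm,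
    abs_le_iff_neg_le_and_le.2 ⟨le_sup_right, sup_le inf_le_right hna⟩,
    abs_le_iff_neg_le_and_le.2 ⟨?_, ?_⟩⟩
  · rw [neg_le, neg_sub, sub_le_iff_le_add]
    refine sup_le (inf_le_left.trans (le_add_of_nonneg_left hb)) ?_
    simpa using add_le_add_right h₁ b
  · rw [sub_le_iff_le_add, ← sub_le_iff_le_add']
    refine le_sup_of_le_left (le_inf (sub_le_self _ hb) ?_)
    rwa [sub_le_iff_le_add]

variable [Module ℝ G] [PosSMulMono ℝ G]

theorem abs_smul_eq_smul_abs (r : ℝ) (z : G) : |r • z| = |r| • |z| := by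
  refine (abs_smul_le_smul_abs r z).antisymm ?_
  rcases eq_or_ne r 0 with rfl | hr
  · simp
  -- The reverse inequality is the first one for `r⁻¹` and `r • z`, multiplied by `|r|`.
  · have h := smul_le_smul_of_nonneg_left (abs_smul_le_smul_abs r⁻¹ (r • z)) (abs_nonneg r)
    rwa [inv_smul_smul₀ hr, smul_smul, abs_inv, mul_inv_cancel₀ (abs_ne_zero.2 hr),
      one_smul] at h

theorem abs_smul_le_abs_smul {y z : G} (r : ℝ) (h : |y| ≤ |z|) : |r • y| ≤ |r • z| := by
  rw [abs_smul_eq_smul_abs, abs_smul_eq_smul_abs]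
  exact smul_le_smul_of_nonneg_left h (abs_nonneg r)

/-- An element dominated by `|r • z|` is `r` times an element dominated by `|z|`. -/
theorem exists_smul_eq_of_abs_le {y z : G} (r : ℝ) (h : |y| ≤ |r • z|) :
    ∃ y', y = r • y' ∧ |y'| ≤ |z| := by
  rcases eq_or_ne r 0 with rfl | hr
  · refine ⟨0, ?_, by simp⟩
    rw [zero_smul, abs_zero, abs_le', neg_nonpos] at h
    rw [le_antisymm h.1 h.2, zero_smul]
  · refine ⟨r⁻¹ • y, (smul_inv_smul₀ hr y).symm, ?_⟩
    simpa [inv_smul_smul₀ hr] using abs_smul_le_abs_smul r⁻¹ h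

/-- The elements all of whose minorants in absolute value lie in the hull form an absolutely convex
set containing `S`. For convexity, a minorant of `r • z₁ + s • z₂` splits by Riesz decomposition
into minorants of the two terms. -/
theorem LatticeOrderedAddCommGroup.IsSolid.isSolid_absConvexHull {S : Set G} (hS : IsSolid S) :
    IsSolid (absConvexHull ℝ S) := by
  suffices absConvexHull ℝ S ⊆ {z | ∀ y, |y| ≤ |z| → y ∈ absConvexHull ℝ S} from
    fun x hx y hy => this hx y hy
  refine absConvexHull_min (fun x hx y hy => subset_absConvexHull (hS hx hy)) ⟨?_, ?_⟩
  · rw [balanced_iff_smul_mem]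
    intro r hr z hz y hy
    obtain ⟨y', rfl, hy'⟩ := exists_smul_eq_of_abs_le r hy
    exact balanced_absConvexHull.smul_mem hr (hz y' hy')
  · intro z₁ hz₁ z₂ hz₂ r s hr hs hrs y hy
    obtain ⟨y₁, y₂, rfl, h₁, h₂⟩ :=
      exists_add_eq_of_abs_le_add (abs_nonneg _) (abs_nonneg _) (hy.trans (abs_add_le _ _))
    obtain ⟨y₁, rfl, h₁'⟩ := exists_smul_eq_of_abs_le r h₁
    obtain ⟨y₂, rfl, h₂'⟩ := exists_smul_eq_of_abs_le s h₂
    exact convex_absConvexHull (hz₁ y₁ h₁') (hz₂ y₂ h₂') hr hs hrs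

end VectorLattice

/-! ### Positivity and absolute values for lattice bimorphisms. -/

section LatticeBimorphism

variable {E F G : Type*}
  [AddCommGroup E] [Lattice E] [Module ℝ E]
  [AddCommGroup F] [Lattice F] [Module ℝ F]
  [AddCommGroup G] [Lattice G] [Module ℝ G]

theorem IsLatticeHomomorphism.map_abs {T : E →ₗ[ℝ] G} (hT : IsLatticeHomomorphism T) (x : E) :
    T |x| = |T x| := by
  rw [abs, hT.1, map_neg, abs]

variable [IsOrderedAddMonoid F] [IsOrderedAddMonoid G]

theorem IsLatticeHomomorphism.map_nonneg {T : F →ₗ[ℝ] G} (hT : IsLatticeHomomorphism T) {x : F}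
    (hx : 0 ≤ x) : 0 ≤ T x := by
  rw [← abs_of_nonneg hx, hT.map_abs]
  exact abs_nonneg _

variable {Φ : E →ₗ[ℝ] F →ₗ[ℝ] G}

theorem IsLatticeBimorphism.nonneg (hΦ : IsLatticeBimorphism Φ) {x : E} {y : F} (hx : 0 ≤ x)
    (hy : 0 ≤ y) : 0 ≤ Φ x y :=
  (hΦ.1 x hx).map_nonneg hy

theorem IsLatticeBimorphism.mono [IsOrderedAddMonoid E] (hΦ : IsLatticeBimorphism Φ) {x x' : E} {y y' : F} (hx : 0 ≤ x)
    (hxx' : x ≤ x') (hy : 0 ≤ y) (hyy' : y ≤ y') : Φ x y ≤ Φ x' y' := by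
  have h₁ := hΦ.nonneg hx (sub_nonneg.2 hyy')
  have h₂ := hΦ.nonneg (sub_nonneg.2 hxx') (hy.trans hyy')
  rw [map_sub, sub_nonneg] at h₁
  rw [map_sub, LinearMap.sub_apply, sub_nonneg] at h₂
  exact h₁.trans h₂

/-- For `z ≥ 0` the map `Φ(·, z)` commutes with absolute values; apply this to the positive and
negative parts of `y`. -/
theorem IsLatticeBimorphism.abs_apply_le (hΦ : IsLatticeBimorphism Φ) (x : E) (y : F) :
    |Φ x y| ≤ Φ |x| |y| := by
  have key : ∀ z : F, 0 ≤ z → |Φ x z| = Φ |x| z := fun z hz => ((hΦ.2 z hz).map_abs x).symm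
  calc |Φ x y| = |Φ x y⁺ + -Φ x y⁻| := by
        rw [← sub_eq_add_neg, ← map_sub, posPart_sub_negPart]
    _ ≤ |Φ x y⁺| + |Φ x y⁻| := (abs_add_le _ _).trans_eq (by rw [abs_neg])
    _ = Φ |x| |y| := by
        rw [key _ (posPart_nonneg y), key _ (negPart_nonneg y), ← map_add, posPart_add_negPart]

end LatticeBimorphism

/-! ### The sets `W_{U,V}` and the linear topology they define. -/

namespace FremlinTensorProduct

variable {E : Type u} {F : Type v}
  [AddCommGroup E] [Lattice E] [Module ℝ E] [AddCommGroup F] [Lattice F] [Module ℝ F]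

theorem convex_fremlinNhd (U : Set E) (V : Set F) : Convex ℝ (fremlinNhd U V) :=
  convex_absConvexHull

theorem balanced_fremlinNhd (U : Set E) (V : Set F) : Balanced ℝ (fremlinNhd U V) :=
  balanced_absConvexHull

theorem isSolid_fremlinNhd (U : Set E) (V : Set F) : IsSolid (fremlinNhd U V) :=
  (isSolid_solidClosure _).isSolid_absConvexHull

theorem tmul_mem_fremlinNhd {U : Set E} {V : Set F} {x : E} {y : F} (hx : x ∈ U) (hy : y ∈ V) :
    tmul x y ∈ fremlinNhd U V :=
  subset_absConvexHull ⟨_, ⟨x, hx, y, hy, rfl⟩, le_rfl⟩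

theorem fremlinNhd_mono {U U' : Set E} {V V' : Set F} (hU : U ⊆ U') (hV : V ⊆ V') :
    fremlinNhd U V ⊆ fremlinNhd U' V' :=
  absConvexHull_mono fun _ ⟨a, ha, h⟩ => ⟨a, Set.image2_subset hU hV ha, h⟩

/-- Since `r • (x ⊗ y) = (r • x) ⊗ y`, the scalar acts on the first factor alone. Taking a preimage
of `U` instead of `r⁻¹ • U` avoids a separate case `r = 0`. -/
theorem smul_mem_fremlinNhd {U : Set E} {V : Set F} (r : ℝ) {z : FremlinTensorProduct E F}
    (hz : z ∈ fremlinNhd ((fun x => r • x) ⁻¹' U) V) : r • z ∈ fremlinNhd U V := by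
  suffices fremlinNhd ((fun x => r • x) ⁻¹' U) V ⊆
      (r • LinearMap.id : FremlinTensorProduct E F →ₗ[ℝ] _) ⁻¹' fremlinNhd U V from this hz
  refine absConvexHull_min ?_ ⟨?_, (convex_fremlinNhd U V).linear_preimage _⟩
  · rintro z ⟨_, ⟨x, hx, y, hy, rfl⟩, h⟩
    refine isSolid_fremlinNhd U V (tmul_mem_fremlinNhd (x := r • x) hx hy) ?_
    rw [map_smul, LinearMap.smul_apply]
    exact abs_smul_le_abs_smul r h
  · rw [balanced_iff_smul_mem]
    intro s hs z hz
    have := (balanced_fremlinNhd U V).smul_mem hs hz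
    rwa [← map_smul] at this

variable [IsOrderedAddMonoid E] [IsOrderedAddMonoid F] [PosSMulMono ℝ E]

/-- Every element of the Fremlin tensor product is dominated by an elementary tensor. -/
theorem exists_abs_le_tmul (t : FremlinTensorProduct E F) :
    ∃ x y, 0 ≤ x ∧ 0 ≤ y ∧ |t| ≤ tmul x y := by
  have hb := isLatticeBimorphism_tmul (E := E) (F := F)
  -- The cross terms in `(x + x') ⊗ (y + y')` are nonnegative, so this tensor dominates the sum. The
  -- bound on `|a| + |b|` serves both `a + b` and `a ⊔ b`.
  have hadd : ∀ a b : FremlinTensorProduct E F,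
      (∃ x y, 0 ≤ x ∧ 0 ≤ y ∧ |a| ≤ tmul x y) → (∃ x y, 0 ≤ x ∧ 0 ≤ y ∧ |b| ≤ tmul x y) →
      ∃ x y, 0 ≤ x ∧ 0 ≤ y ∧ |a| + |b| ≤ tmul x y := by
    rintro a b ⟨x, y, hx, hy, h⟩ ⟨x', y', hx', hy', h'⟩
    refine ⟨x + x', y + y', add_nonneg hx hx', add_nonneg hy hy', ?_⟩
    rw [map_add tmul, LinearMap.add_apply]
    exact add_le_add (h.trans (hb.mono hx le_rfl hy (le_add_of_nonneg_right hy')))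
      (h'.trans (hb.mono hx' le_rfl hy' (le_add_of_nonneg_left hy)))
  induction t using generated with
  | h_tmul x y => exact ⟨|x|, |y|, abs_nonneg x, abs_nonneg y, hb.abs_apply_le x y⟩
  | h_zero => exact ⟨0, 0, le_rfl, le_rfl, by simp⟩
  | h_add a b ha hb =>
    obtain ⟨x, y, hx, hy, h⟩ := hadd a b ha hb
    exact ⟨x, y, hx, hy, (abs_add_le a b).trans h⟩
  | h_smul r a ha =>
    obtain ⟨x, y, hx, hy, h⟩ := ha
    refine ⟨|r| • x, y, smul_nonneg (abs_nonneg r) hx, hy, ?_⟩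
    rw [map_smul, LinearMap.smul_apply, abs_smul_eq_smul_abs]
    exact smul_le_smul_of_nonneg_left h (abs_nonneg r)
  | h_sup a b ha hb =>
    obtain ⟨x, y, hx, hy, h⟩ := hadd a b ha hb
    refine ⟨x, y, hx, hy, le_trans (abs_le_iff_neg_le_and_le.2 ⟨?_, ?_⟩) h⟩
    · exact (neg_le_neg (le_add_of_nonneg_right (abs_nonneg b))).trans
        ((neg_le.1 (neg_le_abs a)).trans le_sup_left)
    · exact sup_le ((le_abs_self a).trans (le_add_of_nonneg_right (abs_nonneg b)))
        ((le_abs_self b).trans (le_add_of_nonneg_left (abs_nonneg a)))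

/-- If `|z| ≤ x ⊗ y`, fix `d > 0` with `d • y ∈ V`. Then `r • z` is dominated by `((r / d) • x) ⊗ (d
• y)`, whose first factor lies in `U` for small `r`. -/
theorem eventually_smul_mem_fremlinNhd [TopologicalSpace E] [TopologicalSpace F]
    [ContinuousSMul ℝ E] [ContinuousSMul ℝ F] {U : Set E} {V : Set F} (hU : U ∈ 𝓝 0)
    (hV : V ∈ 𝓝 0) (z : FremlinTensorProduct E F) : ∀ᶠ r in 𝓝 (0 : ℝ), r • z ∈ fremlinNhd U V := by
  obtain ⟨x, y, hx, hy, h⟩ := exists_abs_le_tmul z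
  have hcF : Filter.Tendsto (fun r : ℝ => r • y) (𝓝 0) (𝓝 0) :=
    Continuous.tendsto' (by fun_prop) _ _ (zero_smul _ _)
  obtain ⟨d, hdV, hd⟩ : ∃ d : ℝ, d • y ∈ V ∧ 0 < d :=
    (((hcF.eventually_mem hV).filter_mono nhdsWithin_le_nhds).and
      (self_mem_nhdsWithin (s := Set.Ioi (0 : ℝ)))).exists
  have hcE : Filter.Tendsto (fun r : ℝ => (r * d⁻¹) • x) (𝓝 0) (𝓝 0) :=
    Continuous.tendsto' (by fun_prop) _ _ (by simp)
  filter_upwards [hcE hU] with r hr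
  refine isSolid_fremlinNhd U V (tmul_mem_fremlinNhd hr hdV) ?_
  rw [map_smul, map_smul, LinearMap.smul_apply, smul_smul, mul_comm, inv_mul_cancel_right₀ hd.ne']
  exact abs_smul_le_abs_smul r (h.trans (le_abs_self _))

variable (E F) in
/-- The sets `W_{U,V}`, for zero neighbourhoods `U` and `V`, define a linear topology. -/
def moduleFilterBasis [TopologicalSpace E] [TopologicalSpace F]
    [ContinuousSMul ℝ E] [ContinuousSMul ℝ F] : ModuleFilterBasis ℝ (FremlinTensorProduct E F) :=
  -- Admitting all zero neighbourhoods, not just those of a base, keeps preimages of `U` under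
  -- scalars admissible.
  have smul_left (r : ℝ) {W : Set (FremlinTensorProduct E F)} :
      W ∈ Set.image2 fremlinNhd (𝓝 (0 : E)).sets (𝓝 (0 : F)).sets →
      ∃ W' ∈ Set.image2 fremlinNhd (𝓝 (0 : E)).sets (𝓝 (0 : F)).sets,
        W' ⊆ (fun z => r • z) ⁻¹' W := by
    rintro ⟨U, hU, V, hV, rfl⟩
    have hr : Filter.Tendsto (fun x : E => r • x) (𝓝 0) (𝓝 0) :=
      Continuous.tendsto' (by fun_prop) _ _ (smul_zero _)
    exact ⟨_, ⟨_, hr hU, V, hV, rfl⟩, fun z hz => smul_mem_fremlinNhd r hz⟩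
  { toAddGroupFilterBasis := addGroupFilterBasisOfComm
      (Set.image2 fremlinNhd (𝓝 (0 : E)).sets (𝓝 (0 : F)).sets)
      ⟨_, Set.univ, Filter.univ_mem, Set.univ, Filter.univ_mem, rfl⟩
      (by
        rintro _ _ ⟨U, hU, V, hV, rfl⟩ ⟨U', hU', V', hV', rfl⟩
        exact ⟨_, ⟨_, Filter.inter_mem hU hU', _, Filter.inter_mem hV hV', rfl⟩,
          Set.subset_inter (fremlinNhd_mono Set.inter_subset_left Set.inter_subset_left)
            (fremlinNhd_mono Set.inter_subset_right Set.inter_subset_right)⟩)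
      (by
        rintro _ ⟨U, hU, V, hV, rfl⟩
        simpa using tmul_mem_fremlinNhd (mem_of_mem_nhds hU) (mem_of_mem_nhds hV))
      (by
        intro W hW
        -- With `2 • W' ⊆ W`, convexity of `W` applies to `a + b = 2⁻¹ • (2 • a) + 2⁻¹ • (2 • b)`.
        obtain ⟨W', hW', h⟩ := smul_left 2 hW
        refine ⟨W', hW', ?_⟩
        obtain ⟨U, hU, V, hV, rfl⟩ := hW
        rintro _ ⟨a, ha, b, hb, rfl⟩
        simpa [smul_smul] using convex_fremlinNhd U V (h ha) (h hb)
          (show (0 : ℝ) ≤ 2⁻¹ by norm_num) (show (0 : ℝ) ≤ 2⁻¹ by norm_num) (by norm_num))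
      (by
        intro W hW
        simpa using smul_left (-1) hW)
    smul' := by
      rintro _ ⟨U, hU, V, hV, rfl⟩
      refine ⟨_, Metric.closedBall_mem_nhds 0 one_pos, _, ⟨U, hU, V, hV, rfl⟩, ?_⟩
      rintro _ ⟨r, hr, z, hz, rfl⟩
      exact (balanced_fremlinNhd U V).smul_mem (by simpa using hr) hz
    smul_left' := smul_left
    smul_right' := by
      rintro z _ ⟨U, hU, V, hV, rfl⟩
      exact eventually_smul_mem_fremlinNhd hU hV z }

end FremlinTensorProduct

/-! ### Existence and uniqueness of the topology. -/

theorem theorem2 {E : Type u} {F : Type v}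
    [AddCommGroup E] [Lattice E] [IsOrderedAddMonoid E] [Module ℝ E] [PosSMulMono ℝ E]
    [IsArchimedeanVectorLattice E]
    [AddCommGroup F] [Lattice F] [IsOrderedAddMonoid F] [Module ℝ F] [PosSMulMono ℝ F]
    [IsArchimedeanVectorLattice F]
    [TopologicalSpace E] [TopologicalSpace F]
    (hE : IsLocallyConvexSolid E) (hF : IsLocallyConvexSolid F) :
    ∃! τ : TopologicalSpace (FremlinTensorProduct E F),
      @IsLocallyConvexSolid (FremlinTensorProduct E F) _ _ _ τ ∧
      ∀ (𝓤 : Set (Set E)) (𝓥 : Set (Set F)),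
        IsConvexSolidZeroBase E 𝓤 → IsConvexSolidZeroBase F 𝓥 →
        @IsConvexSolidZeroBase (FremlinTensorProduct E F) _ _ _ τ
          {W | ∃ U ∈ 𝓤, ∃ V ∈ 𝓥, W = fremlinNhd U V} := by
  have := hE.continuous_smul
  have := hF.continuous_smul
  let B := FremlinTensorProduct.moduleFilterBasis E F
  have base : ∀ (𝓤 : Set (Set E)) (𝓥 : Set (Set F)),
      IsConvexSolidZeroBase E 𝓤 → IsConvexSolidZeroBase F 𝓥 →
      @IsConvexSolidZeroBase (FremlinTensorProduct E F) _ _ _ B.topology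
        {W | ∃ U ∈ 𝓤, ∃ V ∈ 𝓥, W = fremlinNhd U V} := by
    intro 𝓤 𝓥 h𝓤 h𝓥
    let := B.topology
    refine ⟨⟨fun S => ?_⟩, ?_, ?_⟩
    · rw [B.toAddGroupFilterBasis.nhds_zero_hasBasis.mem_iff]
      constructor
      · rintro ⟨_, ⟨U, hU, V, hV, rfl⟩, hS⟩
        obtain ⟨U', hU', hUU'⟩ := h𝓤.hasBasis.mem_iff.1 hU
        obtain ⟨V', hV', hVV'⟩ := h𝓥.hasBasis.mem_iff.1 hV
        exact ⟨_, ⟨U', hU', V', hV', rfl⟩,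
          (FremlinTensorProduct.fremlinNhd_mono hUU' hVV').trans hS⟩
      · rintro ⟨_, ⟨U, hU, V, hV, rfl⟩, hS⟩
        exact ⟨_, ⟨U, h𝓤.hasBasis.mem_of_mem hU, V, h𝓥.hasBasis.mem_of_mem hV, rfl⟩, hS⟩
    · rintro _ ⟨U, -, V, -, rfl⟩
      exact FremlinTensorProduct.convex_fremlinNhd U V
    · rintro _ ⟨U, -, V, -, rfl⟩
      exact FremlinTensorProduct.isSolid_fremlinNhd U V
  -- One pair of bases suffices, both to make the topology locally convex-solid and to compare it
  -- with a competitor `τ`.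
  obtain ⟨𝓤, h𝓤⟩ := hE.exists_base
  obtain ⟨𝓥, h𝓥⟩ := hF.exists_base
  have hB := B.toAddGroupFilterBasis.isTopologicalAddGroup
  refine ⟨B.topology, ⟨?_, base⟩, ?_⟩
  · let := B.topology
    exact ⟨hB.toContinuousAdd, B.continuousSMul, _, base 𝓤 𝓥 h𝓤 h𝓥⟩
  · rintro τ ⟨hτ, hτbase⟩
    have h_add := hτ.continuous_add
    have h_smul := hτ.continuous_smul
    -- Negation is multiplication by `-1`, so `τ` is a group topology and is determined by its zero
    -- neighbourhoods.
    have h_neg : ContinuousNeg (FremlinTensorProduct E F) := .of_continuousConstSMul ℝ _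
    have h_group : IsTopologicalAddGroup (FremlinTensorProduct E F) := ⟨⟩
    exact IsTopologicalAddGroup.ext h_group hB
      ((hτbase 𝓤 𝓥 h𝓤 h𝓥).hasBasis.eq_of_same_basis
        (@IsConvexSolidZeroBase.hasBasis _ _ _ _ B.topology _ (base 𝓤 𝓥 h𝓤 h𝓥)))
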